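/- Let $\sigma,\tau\in\mathbb{C}$ with $\operatorname{Im}\sigma>0$, $\operatorname{Im}\tau>0$, put $p=e^{2\pi i\tau}$, $q=e^{2\pi i\sigma}$ (with $p^{z}:=e^{2\pi i\tau z}$, $q^{z}:=e^{2\pi i\sigma z}$ for $z\in\mathbb{C}$), and let $$[u]=\theta_1(u;\sigma,\tau)=-i\sum_{n\in\mathbb{Z}}(-1)^n p^{(2n+1)^2/8}q^{(n+1/2)u},\qquad [w_1,\ldots,w_k]=\prod_{m=1}^k[w_m].$$ Equalities of meromorphic functions are understood away from a closed discrete set. (i) Let $h\not\equiv0$ be a meromorphic function on $\mathbb{C}$ and $a,b,\gamma\in\mathbb{C}$ such that $$h(x+\sigma^{-1})=a\,h(x),\qquad h(x+\tau\sigma^{-1})=b\,e^{2\pi i\sigma\gamma x}\,h(x).\qquad(1)$$ Then there are non-negative integers $r,s$ and complex numbers $u_1,\ldots,u_r$, $v_1,\ldots,v_s$, $\beta$, $y$ with $y\neq0$ such that $$h(x)=\frac{[x+u_1,\ldots,x+u_r]}{[x+v_1,\ldots,x+v_s]}\,q^{\beta x}\,y\qquad(2)$$ and $$a=(-1)^{r-s}e^{2\pi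 i\beta},\qquad \gamma=s-r,\qquad b=(-1)^{r-s}e^{\pi i\tau(s-r+2\beta)}\,e^{2\pi i\sigma\left(\sum_{m=1}^s v_m-\sum_{m=1}^r u_m\right)}.\qquad(3)$$ Moreover the parameters can be chosen so that the denominator in (2) vanishes only at poles of $h$. (ii) Conversely, for arbitrary non-negative integers $r,s$ and arbitrary complex $u_1,\ldots,u_r,v_1,\ldots,v_s,\beta,y$, the right-hand side of (2) is a meromorphic function on $\mathbb{C}$, is not identically zero if $y\neq 0$, and satisfies (1) with the $a,b,\gamma$ given by (3). If $y\ne0$, then (1) holds for it with no other $a,b,\gamma$. -/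

import Mathlib

open Filter Complex

noncomputable section

/-- The elliptic number `[u; σ, τ]`, i.e. Jacobi's theta function
`θ₁(u; σ, τ) = -i ∑_{n ∈ ℤ} (-1)^n p^{(2n+1)²/8} q^{(n+1/2)u}`,
where `p = e^{2πiτ}` and `q = e^{2πiσ}`. -/
def ellNum (σ τ u : ℂ) : ℂ :=
  -I * ∑' n : ℤ, (-1 : ℂ) ^ n
    * exp (2 * Real.pi * I * τ * ((2 * (n : ℂ) + 1) ^ 2 / 8))
    * exp (2 * Real.pi * I * σ * (((n : ℂ) + 1 / 2) * u))

/-- The product `[x + w_1, …, x + w_k] = ∏ [x + w_m]` of elliptic numbers. -/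
def ellProd (σ τ : ℂ) {k : ℕ} (w : Fin k → ℂ) (x : ℂ) : ℂ :=
  ∏ m : Fin k, ellNum σ τ (x + w m)

/-- The function `x ↦ [x + u_1, …, x + u_r] / [x + v_1, …, x + v_s] · q^{β x} · y`. -/
def thetaQuotient (σ τ : ℂ) {r s : ℕ} (u : Fin r → ℂ) (v : Fin s → ℂ) (β y : ℂ) (x : ℂ) : ℂ :=
  ellProd σ τ u x / ellProd σ τ v x * exp (2 * Real.pi * I * σ * (β * x)) * y

/-- Double quasiperiodicity: `h(x + σ⁻¹) = a h(x)` and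
`h(x + τ σ⁻¹) = b e^{2πiσγx} h(x)`. These are identities between meromorphic functions,
so they are required away from a closed discrete set: the value of a Lean function at a pole
carries no information. -/
def IsDoublyQuasiperiodic (σ τ a b γ : ℂ) (h : ℂ → ℂ) : Prop :=
  (∀ᶠ x in codiscrete ℂ, h (x + σ⁻¹) = a * h x) ∧
  (∀ᶠ x in codiscrete ℂ,
    h (x + τ * σ⁻¹) = b * exp (2 * Real.pi * I * σ * γ * x) * h x)

/-- The relations between the multipliers `a, b, γ` and the parameters `u, v, β`. -/
def MultiplierRelations (σ τ a b γ : ℂ) {r s : ℕ} (u : Fin r → ℂ) (v : Fin s → ℂ) (β : ℂ) :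
    Prop :=
  a = (-1 : ℂ) ^ ((r : ℤ) - (s : ℤ)) * exp (2 * Real.pi * I * β) ∧
  γ = (s : ℂ) - (r : ℂ) ∧
  b = (-1 : ℂ) ^ ((r : ℤ) - (s : ℤ))
    * exp (Real.pi * I * τ * ((s : ℂ) - (r : ℂ) + 2 * β))
    * exp (2 * Real.pi * I * σ * (∑ m, v m - ∑ m, u m))

end

open Filter Complex

noncomputable section

/-! The key fact is that `[u]` is entire with simple zeros exactly on `σ⁻¹(ℤ + τℤ)`. The infinite
product `thetaProd` shows its zeros openly and, with `z = σu`, has the multipliers of the series.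
The series vanishes on the lattice, so series over product has only removable singularities and is
doubly periodic, hence constant (`exists_ellNum_eq_mul_thetaProd`); a Fourier coefficient shows that
the constant is not zero.

Given `h`, its multipliers never vanish, so its order function is periodic and has finite support in
a period parallelogram. Theta factors at these points, with multiplicity, reproduce the divisor of
`h`. Dividing them out leaves a zero-free entire `F`, still doubly quasiperiodic. Then `(F'/F)'` is
doubly periodic, so `F'/F` is affine; its period `σ⁻¹` kills the slope, and `F = y e^{dx}`
(`IsDoublyQuasiperiodic.exists_eq_exp`).

The multiplier relations need no count of zeros and poles: the multipliers of a theta quotient are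
computed factor by factor, and a function that is not identically zero has only one system of them.
-/

/-! ### The theta series: quasiperiodicity and nonvanishing. -/

lemma ellNum_eq_jacobiTheta₂ (σ τ u : ℂ) :
    ellNum σ τ u = -I * exp (Real.pi * I * τ / 4 + Real.pi * I * (σ * u)) *
      jacobiTheta₂ (σ * u + 1 / 2 + τ / 2) τ := by
  rw [ellNum, jacobiTheta₂, mul_assoc (-I)]
  congr 1
  rw [← tsum_mul_left]
  refine tsum_congr fun n => ?_
  have h1 : (-1 : ℂ) ^ n = exp (n * (Real.pi * I)) := by
    rw [exp_int_mul, exp_pi_mul_I]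
  rw [jacobiTheta₂_term, h1, ← exp_add, ← exp_add, ← exp_add]
  congr 1
  ring

lemma differentiable_ellNum (σ : ℂ) {τ : ℂ} (hτ : 0 < τ.im) : Differentiable ℂ (ellNum σ τ) := by
  have h : Differentiable ℂ fun z : ℂ => jacobiTheta₂ z τ :=
    fun z => differentiableAt_jacobiTheta₂_fst z hτ
  rw [show ellNum σ τ = _ from funext (ellNum_eq_jacobiTheta₂ σ τ)]
  have h2 : Differentiable ℂ fun u : ℂ => jacobiTheta₂ (σ * u + 1 / 2 + τ / 2) τ :=
    h.comp (by fun_prop : Differentiable ℂ fun u : ℂ => σ * u + 1 / 2 + τ / 2)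
  fun_prop

lemma ellNum_add_inv {σ : ℂ} (hσ : σ ≠ 0) (τ u : ℂ) : ellNum σ τ (u + σ⁻¹) = -ellNum σ τ u := by
  rw [ellNum_eq_jacobiTheta₂, ellNum_eq_jacobiTheta₂,
    show σ * (u + σ⁻¹) + 1 / 2 + τ / 2 = (σ * u + 1 / 2 + τ / 2) + 1 by field_simp; ring,
    jacobiTheta₂_add_left,
    show Real.pi * I * τ / 4 + Real.pi * I * (σ * (u + σ⁻¹))
      = (Real.pi * I * τ / 4 + Real.pi * I * (σ * u)) + Real.pi * I by field_simp; ring,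
    exp_add _ (Real.pi * I), exp_pi_mul_I]
  ring

lemma ellNum_add_mul_inv {σ : ℂ} (hσ : σ ≠ 0) (τ u : ℂ) :
    ellNum σ τ (u + τ * σ⁻¹) =
      -exp (-Real.pi * I * τ - 2 * Real.pi * I * (σ * u)) * ellNum σ τ u := by
  rw [ellNum_eq_jacobiTheta₂, ellNum_eq_jacobiTheta₂,
    show σ * (u + τ * σ⁻¹) + 1 / 2 + τ / 2 = (σ * u + 1 / 2 + τ / 2) + τ by field_simp; ring,
    jacobiTheta₂_add_left']
  have key : exp (Real.pi * I * τ / 4 + Real.pi * I * (σ * (u + τ * σ⁻¹))) *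
      exp (-Real.pi * I * (τ + 2 * (σ * u + 1 / 2 + τ / 2))) =
      -exp (-Real.pi * I * τ - 2 * Real.pi * I * (σ * u)) *
        exp (Real.pi * I * τ / 4 + Real.pi * I * (σ * u)) := by
    rw [← exp_add, neg_mul (exp _), ← exp_add, ← exp_sub_pi_mul_I]
    congr 1
    field_simp
    ring
  linear_combination (-I * jacobiTheta₂ (σ * u + 1 / 2 + τ / 2) τ) * key

/-- Evenness with period 1, and the shift by `τ`, relate the values of `jacobiTheta₂` at `1/2 ± τ/2`
with opposite signs. -/
lemma ellNum_zero (σ τ : ℂ) : ellNum σ τ 0 = 0 := by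
  have h1 : jacobiTheta₂ (1 / 2 + τ / 2) τ = jacobiTheta₂ (1 / 2 - τ / 2) τ := by
    rw [← jacobiTheta₂_neg_left, ← jacobiTheta₂_add_left]
    congr 1
    ring
  have h2 : jacobiTheta₂ (1 / 2 + τ / 2) τ = -jacobiTheta₂ (1 / 2 - τ / 2) τ := by
    rw [show (1 / 2 + τ / 2 : ℂ) = (1 / 2 - τ / 2) + τ by ring, jacobiTheta₂_add_left',
      show -(Real.pi : ℂ) * I * (τ + 2 * (1 / 2 - τ / 2)) = -(Real.pi * I) by ring, exp_neg,
      exp_pi_mul_I]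
    norm_num
  have h3 : jacobiTheta₂ (1 / 2 + τ / 2) τ = 0 := by linear_combination (h1 + h2) / 2
  rw [ellNum_eq_jacobiTheta₂, mul_zero, zero_add, h3, mul_zero]

/-- Termwise integration keeps only the zeroth Fourier coefficient. It serves to show that theta is
not identically zero. -/
lemma integral_jacobiTheta₂ {τ : ℂ} (hτ : 0 < τ.im) :
    ∫ x in (0 : ℝ)..1, jacobiTheta₂ x τ = 1 := by
  have hterm (n : ℤ) :
      ∫ x in (0 : ℝ)..1, jacobiTheta₂_term n x τ = if n = 0 then 1 else 0 := by
    split_ifs with hn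
    · simp [hn, jacobiTheta₂_term]
    · have hc : (2 * Real.pi * I * n : ℂ) ≠ 0 := by
        simp [hn, Real.pi_ne_zero]
      simp only [jacobiTheta₂_term, exp_add]
      rw [intervalIntegral.integral_mul_const, integral_exp_mul_complex hc]
      have : exp (2 * Real.pi * I * n) = 1 := by
        rw [mul_comm]; exact exp_int_mul_two_pi_mul_I n
      simp [this]
  have hbound (n : ℤ) (x : ℝ) : ‖jacobiTheta₂_term n x τ‖ = ‖jacobiTheta₂_term n 0 τ‖ := by
    simp [norm_jacobiTheta₂_term]
  have hs := (summable_jacobiTheta₂_term_iff 0 τ).mpr hτ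
  have := intervalIntegral.hasSum_integral_of_dominated_convergence (μ := MeasureTheory.volume)
    (a := 0) (b := 1) (F := fun (n : ℤ) (x : ℝ) => jacobiTheta₂_term n x τ)
    (f := fun x : ℝ => jacobiTheta₂ x τ)
    (fun n _ => ‖jacobiTheta₂_term n 0 τ‖)
    (fun n => by
      apply Continuous.aestronglyMeasurable
      unfold jacobiTheta₂_term
      fun_prop)
    (fun n => .of_forall fun x _ => (hbound n x).le)
    (.of_forall fun x _ => hs.norm)
    (by simp)
    (.of_forall fun x _ => hasSum_jacobiTheta₂_term x hτ)
  simp only [hterm] at this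
  exact this.unique (hasSum_ite_eq 0 1)

lemma exists_ellNum_ne_zero {σ τ : ℂ} (hσ : σ ≠ 0) (hτ : 0 < τ.im) : ∃ x, ellNum σ τ x ≠ 0 := by
  by_contra! h
  have h0 (z : ℂ) : jacobiTheta₂ z τ = 0 := by
    have := h (σ⁻¹ * (z - 1 / 2 - τ / 2))
    rw [ellNum_eq_jacobiTheta₂, mul_inv_cancel_left₀ hσ,
      show z - 1 / 2 - τ / 2 + 1 / 2 + τ / 2 = z by ring] at this
    simpa [exp_ne_zero] using this
  simpa [h0] using integral_jacobiTheta₂ hτ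

/-! ### Infinite products. -/

/-- The infinite product `∏_{n ≥ 0} (1 - p^n w)`. -/
def qPochhammer (p w : ℂ) : ℂ := ∏' n : ℕ, (1 - p ^ n * w)

section qPochhammer

variable {p : ℂ}

lemma summable_norm_pow_mul (hp : ‖p‖ < 1) (w : ℂ) : Summable fun n : ℕ => ‖-(p ^ n * w)‖ := by
  simpa using (summable_geometric_of_lt_one (norm_nonneg p) hp).mul_right ‖w‖

lemma multipliable_one_sub_pow_mul (hp : ‖p‖ < 1) (w : ℂ) :
    Multipliable fun n : ℕ => 1 - p ^ n * w := by
  simpa only [sub_eq_add_neg] using multipliable_one_add_of_summable (summable_norm_pow_mul hp w)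

lemma qPochhammer_eq_mul (hp : ‖p‖ < 1) (w : ℂ) :
    qPochhammer p w = (1 - w) * qPochhammer p (p * w) := by
  have h : (fun n : ℕ => 1 - p ^ (n + 1) * w) = fun n : ℕ => 1 - p ^ n * (p * w) := by
    ext n; ring
  have hm : Multipliable fun n : ℕ => 1 - p ^ (n + 1) * w := by
    rw [h]; exact multipliable_one_sub_pow_mul hp _
  rw [qPochhammer, tprod_eq_zero_mul' (f := fun n : ℕ => 1 - p ^ n * w) hm, qPochhammer, h]
  simp

lemma qPochhammer_ne_zero (hp : ‖p‖ < 1) {w : ℂ} (hw : ∀ n : ℕ, p ^ n * w ≠ 1) :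
    qPochhammer p w ≠ 0 := by
  have := tprod_one_add_ne_zero_of_summable (f := fun n : ℕ => -(p ^ n * w))
    (fun n h => hw n (by linear_combination -h)) (summable_norm_pow_mul hp w)
  simpa only [qPochhammer, sub_eq_add_neg] using this

lemma differentiable_qPochhammer (hp : ‖p‖ < 1) : Differentiable ℂ (qPochhammer p) := by
  have h : HasProdLocallyUniformlyOn (fun (n : ℕ) w => 1 - p ^ n * w) (qPochhammer p)
      Set.univ := by
    simp_rw [sub_eq_add_neg]
    apply hasProdLocallyUniformlyOn_of_forall_compact isOpen_univ
    intro K _ hK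
    obtain ⟨R, hR⟩ := hK.isBounded.exists_norm_le
    have := ((summable_geometric_of_lt_one (norm_nonneg p) hp).mul_right
      R).hasProdUniformlyOn_nat_one_add
      (f := fun (n : ℕ) w => -(p ^ n * w)) hK
      (.of_forall fun n x hx => by
        simpa using mul_le_mul_of_nonneg_left (hR x hx) (by positivity))
      (fun _ => by fun_prop)
    convert this using 1
    ext w
    simp only [qPochhammer, sub_eq_add_neg]
  have h2 := h.differentiableOn (.of_forall fun _ ↦ by
    simpa [Finset.prod_fn] using DifferentiableOn.finsetProd (fun _ _ ↦ by fun_prop)) isOpen_univ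
  exact differentiableOn_univ.mp h2

end qPochhammer

/-! ### The theta product and its zeros. -/

/-- The product side of the Jacobi triple product, up to a constant factor. -/
def thetaProd (τ z : ℂ) : ℂ :=
  exp (-(Real.pi * I * z)) * qPochhammer (exp (2 * Real.pi * I * τ)) (exp (2 * Real.pi * I * z)) *
    qPochhammer (exp (2 * Real.pi * I * τ)) (exp (2 * Real.pi * I * (τ - z)))

section thetaProd

variable {τ : ℂ}

lemma norm_exp_two_pi_mul_I_mul_lt_one (hτ : 0 < τ.im) : ‖exp (2 * Real.pi * I * τ)‖ < 1 := by
  rw [norm_exp, Real.exp_lt_one_iff]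
  simp
  positivity

lemma differentiable_thetaProd (hτ : 0 < τ.im) : Differentiable ℂ (thetaProd τ) := by
  have h := differentiable_qPochhammer (norm_exp_two_pi_mul_I_mul_lt_one hτ)
  have h1 := h.comp (by fun_prop : Differentiable ℂ fun z : ℂ => exp (2 * Real.pi * I * z))
  have h2 := h.comp (by fun_prop : Differentiable ℂ fun z : ℂ => exp (2 * Real.pi * I * (τ - z)))
  have h3 : Differentiable ℂ fun z : ℂ => exp (-(Real.pi * I * z)) := by fun_prop
  exact (h3.mul h1).mul h2

lemma thetaProd_add_one (z : ℂ) : thetaProd τ (z + 1) = -thetaProd τ z := by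
  have h1 : exp (2 * Real.pi * I * (z + 1)) = exp (2 * Real.pi * I * z) := by
    rw [mul_add, mul_one, exp_add, exp_two_pi_mul_I, mul_one]
  have h2 : exp (2 * Real.pi * I * (τ - (z + 1))) = exp (2 * Real.pi * I * (τ - z)) := by
    rw [← sub_sub, mul_sub _ _ (1 : ℂ), mul_one, exp_sub, exp_two_pi_mul_I, div_one]
  have h3 : exp (-(Real.pi * I * (z + 1))) = -exp (-(Real.pi * I * z)) := by
    rw [mul_add, mul_one, neg_add, exp_add, exp_neg (Real.pi * I), exp_pi_mul_I]
    norm_num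
  rw [thetaProd, h1, h2, h3, thetaProd]
  ring

/-- The shift removes the factor `1 - e^{2πiz}` from one product and adds `1 - e^{-2πiz}` to the
other; their ratio is a monomial. -/
lemma thetaProd_add (hτ : 0 < τ.im) (z : ℂ) :
    thetaProd τ (z + τ) = -exp (-Real.pi * I * τ - 2 * Real.pi * I * z) * thetaProd τ z := by
  have hp := norm_exp_two_pi_mul_I_mul_lt_one hτ
  have h1 : exp (2 * Real.pi * I * (z + τ)) =
      exp (2 * Real.pi * I * τ) * exp (2 * Real.pi * I * z) := by
    rw [← exp_add]; congr 1; ring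
  have h2 : exp (2 * Real.pi * I * (τ - z)) =
      exp (2 * Real.pi * I * τ) * exp (2 * Real.pi * I * -z) := by
    rw [← exp_add]; congr 1; ring
  have h3 : exp (-Real.pi * I * τ - 2 * Real.pi * I * z) * exp (-(Real.pi * I * z)) =
      exp (-(Real.pi * I * (z + τ))) * exp (2 * Real.pi * I * -z) := by
    rw [← exp_add, ← exp_add]; congr 1; ring
  have h4 : exp (2 * Real.pi * I * -z) * exp (2 * Real.pi * I * z) = 1 := by
    rw [← exp_add, ← exp_zero]; congr 1; ring
  rw [thetaProd, thetaProd, show τ - (z + τ) = -z by ring, h1, h2,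
    qPochhammer_eq_mul hp (exp (2 * Real.pi * I * z)),
    qPochhammer_eq_mul hp (exp (2 * Real.pi * I * -z))]
  set A := qPochhammer (exp (2 * Real.pi * I * τ))
    (exp (2 * Real.pi * I * τ) * exp (2 * Real.pi * I * z))
  set B := qPochhammer (exp (2 * Real.pi * I * τ))
    (exp (2 * Real.pi * I * τ) * exp (2 * Real.pi * I * -z))
  linear_combination (1 - exp (2 * Real.pi * I * z)) * A * B * h3 -
    exp (-(Real.pi * I * (z + τ))) * A * B * h4

/-- The lattice `ℤ + τ ℤ`, as a set. -/
def periodLattice (τ : ℂ) : Set ℂ := {z | ∃ m n : ℤ, z = m + n * τ}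

lemma thetaProd_ne_zero (hτ : 0 < τ.im) {z : ℂ} (hz : z ∉ periodLattice τ) :
    thetaProd τ z ≠ 0 := by
  have hp := norm_exp_two_pi_mul_I_mul_lt_one hτ
  have hpi : (2 * Real.pi * I : ℂ) ≠ 0 := two_pi_I_ne_zero
  refine mul_ne_zero (mul_ne_zero (exp_ne_zero _) (qPochhammer_ne_zero hp ?_))
    (qPochhammer_ne_zero hp ?_)
  · intro n h
    rw [← exp_nat_mul, ← exp_add, exp_eq_one_iff] at h
    obtain ⟨m, hm⟩ := h
    refine hz ⟨m, -n, mul_left_cancel₀ hpi ?_⟩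
    push_cast
    linear_combination hm
  · intro n h
    rw [← exp_nat_mul, ← exp_add, exp_eq_one_iff] at h
    obtain ⟨m, hm⟩ := h
    refine hz ⟨-m, n + 1, mul_left_cancel₀ hpi ?_⟩
    push_cast
    linear_combination -hm

/-- Only the factor `1 - e^{2πiz}` vanishes at 0, and it does so simply; the cofactor `g` has value
`qPochhammer p p ^ 2` there. -/
lemma deriv_thetaProd_zero_ne_zero (hτ : 0 < τ.im) : deriv (thetaProd τ) 0 ≠ 0 := by
  have hp := norm_exp_two_pi_mul_I_mul_lt_one hτ
  set p := exp (2 * Real.pi * I * τ) with hpdef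
  have hnz : qPochhammer p p ≠ 0 := by
    refine qPochhammer_ne_zero hp fun n h => ?_
    have := congrArg norm h
    rw [← pow_succ, norm_pow, norm_one] at this
    exact (pow_lt_one₀ (norm_nonneg _) hp n.succ_ne_zero).ne this
  have hd := differentiable_qPochhammer hp
  set g : ℂ → ℂ := fun z => exp (-(Real.pi * I * z)) *
    qPochhammer p (p * exp (2 * Real.pi * I * z)) *
    qPochhammer p (exp (2 * Real.pi * I * (τ - z))) with hg
  have hgd : Differentiable ℂ g := by
    have h1 := hd.comp (by fun_prop : Differentiable ℂ fun z : ℂ => p * exp (2 * Real.pi * I * z))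
    have h2 := hd.comp
      (by fun_prop : Differentiable ℂ fun z : ℂ => exp (2 * Real.pi * I * (τ - z)))
    have h3 : Differentiable ℂ fun z : ℂ => exp (-(Real.pi * I * z)) := by fun_prop
    exact (h3.mul h1).mul h2
  have hfun : thetaProd τ = fun z => (1 - exp (2 * Real.pi * I * z)) * g z := by
    ext z
    rw [thetaProd, qPochhammer_eq_mul hp (exp (2 * Real.pi * I * z))]
    ring
  have hD : HasDerivAt (fun z : ℂ => 1 - exp (2 * Real.pi * I * z)) (-(2 * Real.pi * I)) 0 := by
    have := (((hasDerivAt_id (0 : ℂ)).const_mul (2 * Real.pi * I)).cexp).const_sub 1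
    simpa using this
  rw [hfun, (hD.fun_mul (hgd 0).hasDerivAt).deriv]
  simp [hg, ← hpdef, hnz, Real.pi_ne_zero]

end thetaProd

/-! ### Identities off a closed discrete set. -/

section codiscrete

lemma eventually_codiscrete_iff {P : ℂ → Prop} :
    (∀ᶠ x in codiscrete ℂ, P x) ↔ ∀ x, ∀ᶠ y in nhdsWithin x {x}ᶜ, P y := by
  simp [Filter.Eventually, codiscrete, mem_codiscreteWithin_iff_forall_mem_nhdsNE]

lemma eventually_codiscrete_comp_add {P : ℂ → Prop} (h : ∀ᶠ x in codiscrete ℂ, P x) (c : ℂ) :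
    ∀ᶠ x in codiscrete ℂ, P (x + c) := by
  rw [eventually_codiscrete_iff] at h ⊢
  intro x
  have ht : Tendsto (fun y : ℂ => y + c) (nhdsWithin x {x}ᶜ) (nhdsWithin (x + c) {x + c}ᶜ) := by
    refine tendsto_nhdsWithin_of_tendsto_nhds_of_eventually_within _ ?_ ?_
    · exact ((continuous_add_const c).tendsto x).mono_left nhdsWithin_le_nhds
    · filter_upwards [self_mem_nhdsWithin] with y hy
      simpa using hy
  exact ht.eventually (h (x + c))

lemma Continuous.eq_of_eventuallyEq_codiscrete {f g : ℂ → ℂ} (hf : Continuous f)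
    (hg : Continuous g) (h : ∀ᶠ x in codiscrete ℂ, f x = g x) (x : ℂ) : f x = g x :=
  tendsto_nhds_unique_of_eventuallyEq ((hf.tendsto x).mono_left nhdsWithin_le_nhds)
    ((hg.tendsto x).mono_left nhdsWithin_le_nhds) (eventually_codiscrete_iff.mp h x)

/-- If all orders of a meromorphic function are non-negative, the function is entire up to
removable singularities. -/
lemma Meromorphic.exists_differentiable {f : ℂ → ℂ} (hf : Meromorphic f)
    (h : ∀ x, 0 ≤ meromorphicOrderAt f x) :
    ∃ F : ℂ → ℂ, Differentiable ℂ F ∧ (∀ᶠ x in codiscrete ℂ, f x = F x) ∧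
      ∀ x, meromorphicOrderAt f x = 0 → F x ≠ 0 := by
  have hf' : MeromorphicOn f Set.univ := hf.meromorphicOn
  have hN := meromorphicNFOn_toMeromorphicNFOn f Set.univ
  refine ⟨toMeromorphicNFOn f Set.univ, fun x => ?_, toMeromorphicNFOn_eqOn_codiscrete hf',
    fun x hx => ?_⟩
  · refine ((hN (Set.mem_univ x)).meromorphicOrderAt_nonneg_iff_analyticAt.mp ?_).differentiableAt
    rw [meromorphicOrderAt_toMeromorphicNFOn hf' (Set.mem_univ x)]
    exact h x
  · rw [← (hN (Set.mem_univ x)).meromorphicOrderAt_eq_zero_iff,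
      meromorphicOrderAt_toMeromorphicNFOn hf' (Set.mem_univ x)]
    exact hx

/-- A zero-free entire factor does not change orders, so quasiperiodicity of `f` becomes periodicity
of its divisor. -/
lemma periodic_meromorphicOrderAt {f g : ℂ → ℂ} {c : ℂ} (hg : Differentiable ℂ g)
    (hg0 : ∀ x, g x ≠ 0) (h : ∀ᶠ x in codiscrete ℂ, f (x + c) = g x * f x) :
    Function.Periodic (meromorphicOrderAt f) c := by
  intro x
  rw [← meromorphicOrderAt_comp_add_const_eq_meromorphicOrderAt,
    ← meromorphicOrderAt_mul_of_ne_zero (f := f) (hg.analyticAt x) (hg0 x)]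
  exact meromorphicOrderAt_congr (eventually_codiscrete_iff.mp h x)

end codiscrete

/-! ### Reduction modulo the period lattice. -/

section periods

variable {τ : ℂ}

/-- The representative of `z` modulo `ℤ + τ ℤ` in the half-open parallelogram spanned by
`1` and `τ`. -/
def periodReduce (τ z : ℂ) : ℂ :=
  (Int.fract (z.re - z.im / τ.im * τ.re) : ℝ) + (Int.fract (z.im / τ.im) : ℝ) * τ

lemma exists_periodReduce (hτ : 0 < τ.im) (z : ℂ) :
    ∃ m n : ℤ, z = periodReduce τ z + (m + n * τ) := by
  refine ⟨⌊z.re - z.im / τ.im * τ.re⌋, ⌊z.im / τ.im⌋, ?_⟩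
  have h1 := Int.fract_add_floor (z.re - z.im / τ.im * τ.re)
  have h2 := Int.fract_add_floor (z.im / τ.im)
  apply Complex.ext
  · simp only [periodReduce, add_re, mul_re, ofReal_re, ofReal_im, intCast_re, intCast_im]
    linear_combination -h1 - τ.re * h2
  · simp only [periodReduce, add_im, mul_im, ofReal_re, ofReal_im, intCast_re, intCast_im]
    linear_combination -τ.im * h2 - div_mul_cancel₀ z.im hτ.ne'

lemma periodReduce_add (hτ : 0 < τ.im) (z : ℂ) (m n : ℤ) :
    periodReduce τ (z + (m + n * τ)) = periodReduce τ z := by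
  have h1 : (z + (m + n * τ)).im / τ.im = z.im / τ.im + n := by
    simp; field_simp
  have h2 : (z + (m + n * τ)).re - (z.im / τ.im + n) * τ.re
      = (z.re - z.im / τ.im * τ.re) + m := by
    simp; ring
  rw [periodReduce, h1, h2, Int.fract_add_intCast, Int.fract_add_intCast, periodReduce]

lemma exists_isCompact_periodReduce_mem (τ : ℂ) :
    ∃ K : Set ℂ, IsCompact K ∧ ∀ z, periodReduce τ z ∈ K := by
  refine ⟨(fun s : ℝ × ℝ => (s.1 + s.2 * τ : ℂ)) '' (Set.Icc 0 1 ×ˢ Set.Icc 0 1),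
    (isCompact_Icc.prod isCompact_Icc).image (by fun_prop), fun z => ?_⟩
  exact ⟨(_, _), ⟨⟨Int.fract_nonneg _, (Int.fract_lt_one _).le⟩,
    ⟨Int.fract_nonneg _, (Int.fract_lt_one _).le⟩⟩, rfl⟩

lemma Function.Periodic.add_period_lattice {α : Type*} {f : ℂ → α} {ω : ℂ}
    (h1 : Function.Periodic f ω) (h2 : Function.Periodic f (τ * ω)) (m n : ℤ) (x : ℂ) :
    f (x + (m + n * τ) * ω) = f x := by
  rw [add_mul, ← add_assoc, mul_assoc, h2.int_mul n, h1.int_mul m]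

/-- An entire doubly periodic function is constant. -/
lemma Differentiable.exists_eq_const_of_doublyPeriodic (hτ : 0 < τ.im) {ω : ℂ} (hω : ω ≠ 0)
    {f : ℂ → ℂ} (hf : Differentiable ℂ f) (h1 : Function.Periodic f ω)
    (h2 : Function.Periodic f (τ * ω)) : ∃ c, ∀ x, f x = c := by
  obtain ⟨K, hK, hmem⟩ := exists_isCompact_periodReduce_mem τ
  have hcont : Continuous fun z => f (z * ω) := hf.continuous.comp (by fun_prop)
  refine ⟨f 0, fun x => hf.apply_eq_apply_of_bounded ((hK.image hcont).isBounded.subset ?_) x 0⟩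
  rintro _ ⟨x, rfl⟩
  obtain ⟨m, n, hmn⟩ := exists_periodReduce hτ (x * ω⁻¹)
  refine ⟨_, hmem (x * ω⁻¹), ?_⟩
  simp only
  rw [← h1.add_period_lattice h2 m n, ← add_mul, ← hmn, inv_mul_cancel_right₀ hω]

end periods

/-! ### Triple product and the divisor of theta. -/

section order

variable {σ τ : ℂ}

lemma thetaProd_zero (hτ : 0 < τ.im) : thetaProd τ 0 = 0 := by
  simp [thetaProd, qPochhammer_eq_mul (norm_exp_two_pi_mul_I_mul_lt_one hτ) 1]

lemma meromorphicOrderAt_thetaProd_of_mem (hτ : 0 < τ.im) {z : ℂ} (hz : z ∈ periodLattice τ) :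
    meromorphicOrderAt (thetaProd τ) z = 1 := by
  have hd := differentiable_thetaProd hτ
  have p1 : Function.Periodic (meromorphicOrderAt (thetaProd τ)) 1 :=
    periodic_meromorphicOrderAt (g := fun _ => -1) (by fun_prop) (by simp)
      (.of_forall fun x => by rw [thetaProd_add_one, neg_one_mul])
  have p2 : Function.Periodic (meromorphicOrderAt (thetaProd τ)) (τ * 1) := by
    rw [mul_one]
    exact periodic_meromorphicOrderAt
      (g := fun z => -exp (-Real.pi * I * τ - 2 * Real.pi * I * z)) (by fun_prop)
      (fun x => neg_ne_zero.mpr (exp_ne_zero _)) (.of_forall fun x => thetaProd_add hτ x)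
  obtain ⟨m, n, rfl⟩ := hz
  have := p1.add_period_lattice p2 m n 0
  rw [zero_add, mul_one] at this
  rw [this, (hd.analyticAt 0).meromorphicOrderAt_eq,
    (hd.analyticAt 0).analyticOrderAt_eq_one_of_zero_deriv_ne_zero (thetaProd_zero hτ)
      (deriv_thetaProd_zero_ne_zero hτ)]
  rfl

/-- A form of the Jacobi triple product identity. -/
lemma exists_ellNum_eq_mul_thetaProd (hσ : σ ≠ 0) (hτ : 0 < τ.im) :
    ∃ c : ℂ, c ≠ 0 ∧ ∀ x, ellNum σ τ x = c * thetaProd τ (σ * x) := by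
  have hd := differentiable_thetaProd hτ
  set N : ℂ → ℂ := fun z => ellNum σ τ (σ⁻¹ * z) with hN
  have hNd : Differentiable ℂ N := (differentiable_ellNum σ hτ).comp (by fun_prop)
  have hN1 (z : ℂ) : N (z + 1) = -N z := by
    simp only [hN, mul_add, mul_one, ellNum_add_inv hσ]
  have hN2 (z : ℂ) : N (z + τ) = -exp (-Real.pi * I * τ - 2 * Real.pi * I * z) * N z := by
    simp only [hN, mul_add, mul_comm σ⁻¹ τ, ellNum_add_mul_inv hσ, mul_inv_cancel_left₀ hσ]
  have hN0 {z : ℂ} (hz : z ∈ periodLattice τ) : N z = 0 := by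
    have p1 : Function.Periodic (fun z => N z = 0) 1 := fun z => by simp [hN1]
    have p2 : Function.Periodic (fun z => N z = 0) (τ * 1) := fun z => by
      simp [hN2, exp_ne_zero]
    obtain ⟨m, n, rfl⟩ := hz
    have := p1.add_period_lattice p2 m n 0
    rw [zero_add, mul_one] at this
    rw [this]
    simp [hN, ellNum_zero]
  have hR : Meromorphic fun z => N z / thetaProd τ z :=
    Meromorphic.fun_div (fun z => (hNd.analyticAt z).meromorphicAt)
      fun z => (hd.analyticAt z).meromorphicAt
  -- The denominator has only simple zeros, at lattice points, where `N` vanishes too.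
  have hord (z : ℂ) : 0 ≤ meromorphicOrderAt (fun z => N z / thetaProd τ z) z := by
    rw [fun_meromorphicOrderAt_div (hNd.analyticAt z).meromorphicAt
      (hd.analyticAt z).meromorphicAt]
    by_cases hz : z ∈ periodLattice τ
    · rw [meromorphicOrderAt_thetaProd_of_mem hτ hz]
      have hpos : 0 < meromorphicOrderAt N z := by
        rw [← tendsto_zero_iff_meromorphicOrderAt_pos (hNd.analyticAt z).meromorphicAt,
          ← hN0 hz]
        exact (hNd.continuous.tendsto z).mono_left nhdsWithin_le_nhds
      revert hpos
      cases meromorphicOrderAt N z with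
      | top => intro _; simp
      | coe k =>
        intro hk
        have hk' : 0 < k := by exact_mod_cast hk
        exact_mod_cast (by omega : 0 ≤ k - 1)
    · rw [((hd.analyticAt z).meromorphicNFAt.meromorphicOrderAt_eq_zero_iff).mpr
        (thetaProd_ne_zero hτ hz), sub_zero]
      exact (hNd.analyticAt z).meromorphicOrderAt_nonneg
  obtain ⟨F, hF, hFR, -⟩ := hR.exists_differentiable hord
  have hp1 : Function.Periodic F 1 := by
    refine fun x => Continuous.eq_of_eventuallyEq_codiscrete (f := fun x => F (x + 1))
      (hF.continuous.comp (by fun_prop)) hF.continuous ?_ x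
    filter_upwards [hFR, eventually_codiscrete_comp_add hFR 1] with x h1 h2
    rw [← h1, ← h2, hN1, thetaProd_add_one, neg_div_neg_eq]
  have hp2 : Function.Periodic F (τ * 1) := by
    rw [mul_one]
    refine fun x => Continuous.eq_of_eventuallyEq_codiscrete (f := fun x => F (x + τ))
      (hF.continuous.comp (by fun_prop)) hF.continuous ?_ x
    filter_upwards [hFR, eventually_codiscrete_comp_add hFR τ] with x h1 h2
    rw [← h1, ← h2, hN2, thetaProd_add hτ, mul_div_mul_left]
    exact neg_ne_zero.mpr (exp_ne_zero _)
  obtain ⟨c, hc⟩ := hF.exists_eq_const_of_doublyPeriodic hτ one_ne_zero hp1 hp2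
  have hthne : ∀ᶠ z in codiscrete ℂ, thetaProd τ z ≠ 0 := by
    refine eventually_codiscrete_iff.mpr fun z => ?_
    rw [← meromorphicOrderAt_ne_top_iff_eventually_ne_zero (hd.analyticAt z).meromorphicAt]
    by_cases hz : z ∈ periodLattice τ
    · rw [meromorphicOrderAt_thetaProd_of_mem hτ hz]
      simp
    · rw [((hd.analyticAt z).meromorphicNFAt.meromorphicOrderAt_eq_zero_iff).mpr
        (thetaProd_ne_zero hτ hz)]
      simp
  have heq (z : ℂ) : N z = c * thetaProd τ z := by
    refine Continuous.eq_of_eventuallyEq_codiscrete (g := fun z => c * thetaProd τ z)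
      hNd.continuous (hd.continuous.const_mul c) ?_ z
    filter_upwards [hFR, hthne] with x h1 h2
    rw [← hc x, ← h1, div_mul_cancel₀ _ h2]
  have hmain (x : ℂ) : ellNum σ τ x = c * thetaProd τ (σ * x) := by
    rw [← heq, hN]
    simp [hσ]
  refine ⟨c, ?_, hmain⟩
  rintro rfl
  obtain ⟨x, hx⟩ := exists_ellNum_ne_zero hσ hτ
  exact hx (by simp [hmain])

lemma ellNum_eq_zero_iff (hσ : σ ≠ 0) (hτ : 0 < τ.im) {x : ℂ} :
    ellNum σ τ x = 0 ↔ σ * x ∈ periodLattice τ := by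
  obtain ⟨c, hc, h⟩ := exists_ellNum_eq_mul_thetaProd hσ hτ
  rw [h, mul_eq_zero, or_iff_right hc]
  refine ⟨fun hx => by_contra fun hx' => thetaProd_ne_zero hτ hx' hx, fun hx => ?_⟩
  have hd := differentiable_thetaProd hτ
  by_contra hne
  rw [← ne_eq, ← ((hd.analyticAt (σ * x)).meromorphicNFAt).meromorphicOrderAt_eq_zero_iff,
    meromorphicOrderAt_thetaProd_of_mem hτ hx] at hne
  exact one_ne_zero hne

open Classical in
lemma meromorphicOrderAt_ellNum (hσ : σ ≠ 0) (hτ : 0 < τ.im) (x : ℂ) :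
    meromorphicOrderAt (ellNum σ τ) x = ((if σ * x ∈ periodLattice τ then 1 else 0 : ℤ)) := by
  split_ifs with hx
  · obtain ⟨c, hc, h⟩ := exists_ellNum_eq_mul_thetaProd hσ hτ
    rw [show ellNum σ τ = (fun _ => c) * (thetaProd τ ∘ fun x => σ * x) from funext h,
      meromorphicOrderAt_mul_of_ne_zero analyticAt_const hc,
      meromorphicOrderAt_comp_of_deriv_ne_zero (by fun_prop) (by simp [hσ]),
      meromorphicOrderAt_thetaProd_of_mem hτ hx]
    rfl
  · rw [(((differentiable_ellNum σ hτ).analyticAt x).meromorphicNFAt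
      |>.meromorphicOrderAt_eq_zero_iff).mpr (mt (ellNum_eq_zero_iff hσ hτ).mp hx)]
    rfl

end order

/-! ### Multipliers: products and uniqueness. -/

section quasiperiodic

variable {σ τ a b γ a' b' γ' : ℂ} {f g h : ℂ → ℂ}

lemma IsDoublyQuasiperiodic.congr (hf : IsDoublyQuasiperiodic σ τ a b γ f)
    (hfg : ∀ᶠ x in codiscrete ℂ, f x = g x) : IsDoublyQuasiperiodic σ τ a b γ g := by
  constructor
  · filter_upwards [hf.1, hfg, eventually_codiscrete_comp_add hfg σ⁻¹] with x h1 h2 h3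
    rw [← h3, ← h2, h1]
  · filter_upwards [hf.2, hfg, eventually_codiscrete_comp_add hfg (τ * σ⁻¹)] with x h1 h2 h3
    rw [← h3, ← h2, h1]

lemma IsDoublyQuasiperiodic.mul (hf : IsDoublyQuasiperiodic σ τ a b γ f)
    (hg : IsDoublyQuasiperiodic σ τ a' b' γ' g) :
    IsDoublyQuasiperiodic σ τ (a * a') (b * b') (γ + γ') fun x => f x * g x := by
  constructor
  · filter_upwards [hf.1, hg.1] with x h1 h2
    rw [h1, h2]
    ring
  · filter_upwards [hf.2, hg.2] with x h1 h2
    rw [h1, h2, mul_add _ γ γ', add_mul, exp_add]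
    ring

/-- With a zero multiplier, translating back makes `f` vanish off a discrete set. -/
lemma IsDoublyQuasiperiodic.multipliers_ne_zero (hf : IsDoublyQuasiperiodic σ τ a b γ f)
    (hf0 : ¬ ∀ᶠ x in codiscrete ℂ, f x = 0) : a ≠ 0 ∧ b ≠ 0 := by
  constructor <;> rintro rfl <;> refine hf0 ?_
  · simpa using eventually_codiscrete_comp_add hf.1 (-σ⁻¹)
  · simpa using eventually_codiscrete_comp_add hf.2 (-(τ * σ⁻¹))

/-- A function that vanishes only on a closed discrete set has at most one system of
multipliers. -/
lemma IsDoublyQuasiperiodic.multipliers_unique (hσ : σ ≠ 0)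
    (hf : IsDoublyQuasiperiodic σ τ a b γ f) (hf' : IsDoublyQuasiperiodic σ τ a' b' γ' f)
    (hf0 : ∀ᶠ x in codiscrete ℂ, f x ≠ 0) (hb : b ≠ 0) : a = a' ∧ b = b' ∧ γ = γ' := by
  have ha : a = a' := by
    refine Continuous.eq_of_eventuallyEq_codiscrete (f := fun _ => a) (g := fun _ => a')
      continuous_const continuous_const ?_ 0
    filter_upwards [hf.1, hf'.1, hf0] with x h1 h2 h3
    exact mul_right_cancel₀ h3 (h1.symm.trans h2)
  have hexp : (fun x => b * exp (2 * Real.pi * I * σ * γ * x)) =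
      fun x => b' * exp (2 * Real.pi * I * σ * γ' * x) := by
    ext x
    refine Continuous.eq_of_eventuallyEq_codiscrete
      (f := fun x => b * exp (2 * Real.pi * I * σ * γ * x))
      (g := fun x => b' * exp (2 * Real.pi * I * σ * γ' * x)) (by fun_prop) (by fun_prop) ?_ x
    filter_upwards [hf.2, hf'.2, hf0] with x h1 h2 h3
    exact mul_right_cancel₀ h3 (h1.symm.trans h2)
  have hbb : b = b' := by simpa using congrFun hexp 0
  have hder (b c : ℂ) : deriv (fun x => b * exp (c * x)) 0 = b * c := by
    have := ((((hasDerivAt_id (0 : ℂ)).const_mul c).cexp).const_mul b).deriv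
    simpa using this
  -- The value at 0 gave `b`; the derivative at 0 gives `b` times the exponent, hence `γ`.
  have hd := congrArg (fun F => deriv F 0) hexp
  simp only [hder, ← hbb] at hd
  refine ⟨ha, hbb, ?_⟩
  exact mul_left_cancel₀ (mul_ne_zero two_pi_I_ne_zero hσ) (mul_left_cancel₀ hb hd)

end quasiperiodic

/-! ### Multipliers of theta quotients. -/

section thetaQuotient

variable {σ τ : ℂ} {k r s : ℕ}

lemma differentiable_ellProd (σ : ℂ) (hτ : 0 < τ.im) (w : Fin k → ℂ) :
    Differentiable ℂ (ellProd σ τ w) := by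
  unfold ellProd
  have := differentiable_ellNum σ hτ
  refine Differentiable.fun_finsetProd fun i _ => this.comp (by fun_prop)

lemma eventually_ellProd_ne_zero (hσ : σ ≠ 0) (hτ : 0 < τ.im) (w : Fin k → ℂ) :
    ∀ᶠ x in codiscrete ℂ, ellProd σ τ w x ≠ 0 := by
  have h : ∀ᶠ x in codiscrete ℂ, ellNum σ τ x ≠ 0 := by
    refine eventually_codiscrete_iff.mpr fun x => ?_
    rw [← meromorphicOrderAt_ne_top_iff_eventually_ne_zero
      ((differentiable_ellNum σ hτ).analyticAt x).meromorphicAt, meromorphicOrderAt_ellNum hσ hτ]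
    exact WithTop.coe_ne_top
  filter_upwards [eventually_all.mpr fun i => eventually_codiscrete_comp_add h (w i)] with x hx
  exact Finset.prod_ne_zero_iff.mpr fun i _ => hx i

lemma ellProd_add_inv (hσ : σ ≠ 0) (w : Fin k → ℂ) (x : ℂ) :
    ellProd σ τ w (x + σ⁻¹) = (-1) ^ k * ellProd σ τ w x := by
  simp [ellProd, add_right_comm x σ⁻¹, ellNum_add_inv hσ, Finset.prod_neg]

lemma ellProd_add_mul_inv (hσ : σ ≠ 0) (w : Fin k → ℂ) (x : ℂ) :
    ellProd σ τ w (x + τ * σ⁻¹) =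
      (-1) ^ k * exp (-Real.pi * I * τ * k - 2 * Real.pi * I * σ * (k * x + ∑ m, w m)) *
        ellProd σ τ w x := by
  simp only [ellProd, add_right_comm x (τ * σ⁻¹), ellNum_add_mul_inv hσ, Finset.prod_mul_distrib,
    Finset.prod_neg, ← exp_sum, Finset.card_univ, Fintype.card_fin]
  congr 3
  simp only [Finset.sum_sub_distrib, mul_add, Finset.sum_add_distrib, Finset.mul_sum,
    Finset.sum_const, Finset.card_univ, Fintype.card_fin, nsmul_eq_mul]
  simp only [← Finset.mul_sum]
  ring

lemma meromorphic_thetaQuotient (σ : ℂ) (hτ : 0 < τ.im) (u : Fin r → ℂ) (v : Fin s → ℂ)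
    (β y : ℂ) : Meromorphic (thetaQuotient σ τ u v β y) := by
  intro x
  have hu := ((differentiable_ellProd σ hτ u).analyticAt x).meromorphicAt
  have hv := ((differentiable_ellProd σ hτ v).analyticAt x).meromorphicAt
  have he : MeromorphicAt (fun x => exp (2 * Real.pi * I * σ * (β * x))) x :=
    AnalyticAt.meromorphicAt (by fun_prop)
  exact ((hu.div hv).mul he).mul (.const y x)

lemma eventually_thetaQuotient_ne_zero (hσ : σ ≠ 0) (hτ : 0 < τ.im) (u : Fin r → ℂ)
    (v : Fin s → ℂ) (β : ℂ) {y : ℂ} (hy : y ≠ 0) :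
    ∀ᶠ x in codiscrete ℂ, thetaQuotient σ τ u v β y x ≠ 0 := by
  filter_upwards [eventually_ellProd_ne_zero hσ hτ u, eventually_ellProd_ne_zero hσ hτ v]
    with x hu hv
  exact mul_ne_zero (mul_ne_zero (div_ne_zero hu hv) (exp_ne_zero _)) hy

lemma neg_one_zpow_natCast_sub (r s : ℕ) :
    (-1 : ℂ) ^ ((r : ℤ) - (s : ℤ)) = (-1) ^ r / (-1) ^ s := by
  rw [zpow_sub₀ (by norm_num), zpow_natCast, zpow_natCast]

lemma MultiplierRelations.isDoublyQuasiperiodic (hσ : σ ≠ 0) {a b γ : ℂ} {u : Fin r → ℂ}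
    {v : Fin s → ℂ} {β : ℂ} (h : MultiplierRelations σ τ a b γ u v β) (y : ℂ) :
    IsDoublyQuasiperiodic σ τ a b γ (thetaQuotient σ τ u v β y) := by
  obtain ⟨rfl, rfl, rfl⟩ := h
  refine ⟨.of_forall fun x => ?_, .of_forall fun x => ?_⟩
  · have he : exp (2 * Real.pi * I * σ * (β * (x + σ⁻¹))) =
        exp (2 * Real.pi * I * β) * exp (2 * Real.pi * I * σ * (β * x)) := by
      rw [← exp_add]; congr 1; field_simp; ring
    rw [thetaQuotient, thetaQuotient, ellProd_add_inv hσ, ellProd_add_inv hσ, he,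
      neg_one_zpow_natCast_sub, mul_div_mul_comm]
    ring
  · have he : exp (2 * Real.pi * I * σ * (β * (x + τ * σ⁻¹))) =
        exp (2 * Real.pi * I * τ * β) * exp (2 * Real.pi * I * σ * (β * x)) := by
      rw [← exp_add]; congr 1; field_simp; ring
    have he2 : exp (-Real.pi * I * τ * r - 2 * Real.pi * I * σ * (r * x + ∑ m, u m)) /
        exp (-Real.pi * I * τ * s - 2 * Real.pi * I * σ * (s * x + ∑ m, v m)) *
          exp (2 * Real.pi * I * τ * β) =
        exp (Real.pi * I * τ * ((s : ℂ) - (r : ℂ) + 2 * β)) *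
          exp (2 * Real.pi * I * σ * (∑ m, v m - ∑ m, u m)) *
          exp (2 * Real.pi * I * σ * (s - r) * x) := by
      rw [← exp_sub, ← exp_add, ← exp_add, ← exp_add]; congr 1; ring
    rw [thetaQuotient, thetaQuotient, ellProd_add_mul_inv hσ, ellProd_add_mul_inv hσ, he,
      neg_one_zpow_natCast_sub, mul_div_mul_comm, mul_div_mul_comm]
    linear_combination ((-1) ^ r / (-1) ^ s) * (ellProd σ τ u x / ellProd σ τ v x) *
      exp (2 * Real.pi * I * σ * (β * x)) * y * he2

lemma multiplierRelations_of_isDoublyQuasiperiodic (hσ : σ ≠ 0) (hτ : 0 < τ.im) {a b γ : ℂ}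
    {u : Fin r → ℂ} {v : Fin s → ℂ} {β y : ℂ} (hy : y ≠ 0)
    (h : IsDoublyQuasiperiodic σ τ a b γ (thetaQuotient σ τ u v β y)) :
    MultiplierRelations σ τ a b γ u v β := by
  have h0 : MultiplierRelations σ τ _ _ _ u v β := ⟨rfl, rfl, rfl⟩
  obtain ⟨rfl, rfl, rfl⟩ := (h0.isDoublyQuasiperiodic hσ y).multipliers_unique hσ h
    (eventually_thetaQuotient_ne_zero hσ hτ u v β hy)
    (mul_ne_zero (mul_ne_zero (zpow_ne_zero _ (by norm_num)) (exp_ne_zero _)) (exp_ne_zero _))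
  exact h0

end thetaQuotient

/-! ### Zero-free quasiperiodic functions. -/

/-- A zero-free entire function that is doubly quasiperiodic is an exponential. -/
lemma IsDoublyQuasiperiodic.exists_eq_exp {σ τ a b γ : ℂ} (hσ : σ ≠ 0) (hτ : 0 < τ.im)
    {F : ℂ → ℂ} (hF : Differentiable ℂ F) (hF0 : ∀ x, F x ≠ 0)
    (h : IsDoublyQuasiperiodic σ τ a b γ F) : ∃ d y : ℂ, y ≠ 0 ∧ ∀ x, F x = y * exp (d * x) := by
  -- A multiplier `A e^{κx}` becomes the additive constant `κ` under the logarithmic derivative.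
  have hshift {c A κ : ℂ}
      (hc : ∀ᶠ x in codiscrete ℂ, F (x + c) = A * exp (κ * x) * F x) (hA : A ≠ 0) (x : ℂ) :
      logDeriv F (x + c) = logDeriv F x + κ := by
    have heq : (fun x => F (x + c)) = fun x => A * exp (κ * x) * F x := by
      ext x
      exact Continuous.eq_of_eventuallyEq_codiscrete (f := fun x => F (x + c))
        (g := fun x => A * exp (κ * x) * F x) (hF.continuous.comp (by fun_prop))
        ((by fun_prop : Continuous fun x : ℂ => A * exp (κ * x)).mul hF.continuous) hc x
    have hE : HasDerivAt (fun x => A * exp (κ * x)) (A * exp (κ * x) * κ) x := by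
      have := (((hasDerivAt_id x).const_mul κ).cexp).const_mul A
      simpa [mul_assoc] using this
    have hd := congrArg (fun G => deriv G x) heq
    simp only [deriv_comp_add_const, (hE.fun_mul (hF x).hasDerivAt).deriv] at hd
    have hv := congrFun heq x
    have he := exp_ne_zero (κ * x)
    have hx := hF0 x
    rw [logDeriv_apply, logDeriv_apply, hd, hv]
    field_simp
    ring
  have hne : ¬ ∀ᶠ x in codiscrete ℂ, F x = 0 := fun h0 =>
    hF0 0 (hF.continuous.eq_of_eventuallyEq_codiscrete continuous_const h0 0)
  obtain ⟨ha, hb⟩ := h.multipliers_ne_zero hne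
  have h1 (x : ℂ) : logDeriv F (x + σ⁻¹) = logDeriv F x := by
    rw [hshift (κ := 0) (by simpa using h.1) ha x, add_zero]
  have h2 := hshift h.2 hb
  have hFd : Differentiable ℂ (deriv F) := fun x => (hF.analyticAt x).deriv.differentiableAt
  have hL : Differentiable ℂ (logDeriv F) := fun x => (hFd x).div (hF x) (hF0 x)
  have hL' : Differentiable ℂ (deriv (logDeriv F)) :=
    fun x => (hL.analyticAt x).deriv.differentiableAt
  have p1 : Function.Periodic (deriv (logDeriv F)) σ⁻¹ := fun x => by
    rw [← deriv_comp_add_const, funext h1]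
  have p2 : Function.Periodic (deriv (logDeriv F)) (τ * σ⁻¹) := fun x => by
    rw [← deriv_comp_add_const, funext h2, deriv_add_const]
  obtain ⟨c, hc⟩ := hL'.exists_eq_const_of_doublyPeriodic hτ (inv_ne_zero hσ) p1 p2
  have hlin (x : ℂ) : logDeriv F x = logDeriv F 0 + c * x := by
    have := is_const_of_deriv_eq_zero (f := fun x => logDeriv F x - c * x)
      (hL.sub (by fun_prop)) (fun x => by
        have := ((hL x).hasDerivAt.fun_sub ((hasDerivAt_id x).const_mul c)).deriv
        simp only [id_eq, hc, mul_one, sub_self] at this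
        exact this) x 0
    linear_combination this
  have hc0 : c = 0 := by
    have := h1 0
    rw [zero_add, hlin σ⁻¹, add_eq_left] at this
    exact (mul_eq_zero.mp this).resolve_right (inv_ne_zero hσ)
  set d := logDeriv F 0 with hd
  have hderiv (x : ℂ) : deriv F x = d * F x := by
    have := hlin x
    rw [hc0, zero_mul, add_zero, logDeriv_apply, div_eq_iff (hF0 x)] at this
    exact this
  refine ⟨d, F 0, hF0 0, fun x => ?_⟩
  have hE (x : ℂ) : HasDerivAt (fun x => exp (-(d * x))) (exp (-(d * x)) * -d) x := by
    have := (((hasDerivAt_id x).const_mul d).fun_neg).cexp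
    simpa using this
  have := is_const_of_deriv_eq_zero (f := fun x => F x * exp (-(d * x)))
    (hF.mul (by fun_prop)) (fun x => by
      rw [((hF x).hasDerivAt.fun_mul (hE x)).deriv, hderiv]
      ring) x 0
  simp only [mul_zero, neg_zero, exp_zero, mul_one] at this
  rw [← this, mul_assoc, ← exp_add, neg_add_cancel, exp_zero, mul_one]

/-! ### Theta products with a prescribed divisor. -/

section divisor

variable {σ τ : ℂ}

/-- The representative of `x` modulo `(ℤ + τ ℤ) σ⁻¹` in a fundamental parallelogram. -/
def latticeRep (σ τ x : ℂ) : ℂ := σ⁻¹ * periodReduce τ (σ * x)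

lemma Function.Periodic.latticeRep {α : Type*} {f : ℂ → α} (hσ : σ ≠ 0) (hτ : 0 < τ.im)
    (h1 : Function.Periodic f σ⁻¹) (h2 : Function.Periodic f (τ * σ⁻¹)) (x : ℂ) :
    f (latticeRep σ τ x) = f x := by
  obtain ⟨m, n, hmn⟩ := exists_periodReduce hτ (σ * x)
  rw [← h1.add_period_lattice h2 m n]
  congr 1
  rw [_root_.latticeRep]
  field_simp
  linear_combination -hmn

lemma latticeRep_latticeRep (hσ : σ ≠ 0) (hτ : 0 < τ.im) (x : ℂ) :
    latticeRep σ τ (latticeRep σ τ x) = latticeRep σ τ x := by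
  obtain ⟨m, n, hmn⟩ := exists_periodReduce hτ (σ * x)
  rw [latticeRep, latticeRep, mul_inv_cancel_left₀ hσ, ← periodReduce_add hτ _ m n, ← hmn]

lemma mul_sub_mem_periodLattice_iff (hσ : σ ≠ 0) (hτ : 0 < τ.im) {x z : ℂ}
    (hz : latticeRep σ τ z = z) : σ * (x - z) ∈ periodLattice τ ↔ latticeRep σ τ x = z := by
  constructor
  · rintro ⟨m, n, h⟩
    rw [← hz, latticeRep, latticeRep, ← periodReduce_add hτ (σ * z) m n, ← h]
    congr 2
    ring
  · rintro rfl
    obtain ⟨m, n, hmn⟩ := exists_periodReduce hτ (σ * x)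
    refine ⟨m, n, ?_⟩
    rw [latticeRep, mul_sub, mul_inv_cancel_left₀ hσ]
    linear_combination hmn

/-- Multiplicities are unfolded by listing `-z` exactly `n z` times, through an enumeration of a
sigma type. -/
lemma exists_ellProd_eq_prod_pow (σ τ : ℂ) (S : Finset ℂ) (n : ℂ → ℕ) :
    ∃ (k : ℕ) (w : Fin k → ℂ), ∀ x, ellProd σ τ w x = ∏ z ∈ S, ellNum σ τ (x - z) ^ n z := by
  let e := (Fintype.equivFin (Σ z : S, Fin (n z))).symm
  refine ⟨_, fun i => -((e i).1 : ℂ), fun x => ?_⟩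
  rw [ellProd, e.prod_comp fun j => ellNum σ τ (x + -(j.1 : ℂ)), Fintype.prod_sigma]
  simp only [← sub_eq_add_neg, Finset.prod_const, Finset.card_univ, Fintype.card_fin]
  exact Finset.prod_coe_sort S fun z => ellNum σ τ (x - z) ^ n z

/-- Points of `S` are their own representatives, so at most one factor vanishes at `x`. -/
lemma meromorphicOrderAt_prod_ellNum_pow (hσ : σ ≠ 0) (hτ : 0 < τ.im) {S : Finset ℂ}
    (hS : ∀ z ∈ S, latticeRep σ τ z = z) (n : ℂ → ℕ) (x : ℂ) :
    meromorphicOrderAt (fun y => ∏ z ∈ S, ellNum σ τ (y - z) ^ n z) x =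
      ((if latticeRep σ τ x ∈ S then (n (latticeRep σ τ x) : ℤ) else 0 : ℤ)) := by
  classical
  have hd (z : ℂ) : Differentiable ℂ fun y => ellNum σ τ (y - z) :=
    (differentiable_ellNum σ hτ).comp (by fun_prop)
  have hm (z : ℂ) : MeromorphicAt (fun y => ellNum σ τ (y - z)) x :=
    ((hd z).analyticAt x).meromorphicAt
  have hterm (z : ℂ) (hz : z ∈ S) :
      meromorphicOrderAt (fun y => ellNum σ τ (y - z) ^ n z) x =
        ((if latticeRep σ τ x = z then (n z : ℤ) else 0 : ℤ)) := by
    rw [fun_meromorphicOrderAt_pow (hm z)]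
    have := meromorphicOrderAt_comp_add_const_eq_meromorphicOrderAt (f := ellNum σ τ) (x := x)
      (c := -z)
    simp only [← sub_eq_add_neg] at this
    rw [show (fun y => ellNum σ τ (y - z)) = ellNum σ τ ∘ fun y => y - z from rfl, this,
      meromorphicOrderAt_ellNum hσ hτ,
      if_congr (mul_sub_mem_periodLattice_iff hσ hτ (hS z hz)) rfl rfl]
    split_ifs
    · simp
    · simp
  rw [meromorphicOrderAt_fun_prod fun z _ => (hm z).fun_pow _, Finset.sum_congr rfl hterm,
    ← WithTop.coe_sum, Finset.sum_ite_eq]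

/-- Representatives lie in a compact set, on which a divisor has finite support. -/
lemma exists_finset_latticeRep (hσ : σ ≠ 0) (hτ : 0 < τ.im) {h : ℂ → ℂ} (hh : Meromorphic h) :
    ∃ S : Finset ℂ, (∀ z ∈ S, latticeRep σ τ z = z) ∧
      ∀ x, (meromorphicOrderAt h (latticeRep σ τ x)).untop₀ ≠ 0 → latticeRep σ τ x ∈ S := by
  classical
  obtain ⟨K, hK, hmem⟩ := exists_isCompact_periodReduce_mem τ
  have hK' : IsCompact ((fun z => σ⁻¹ * z) '' K) := hK.image (by fun_prop)
  have hfin := (MeromorphicOn.divisor h ((fun z => σ⁻¹ * z) '' K)).finiteSupport hK'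
  refine ⟨hfin.toFinset.filter fun z => latticeRep σ τ z = z, fun z hz =>
    (Finset.mem_filter.mp hz).2, fun x hx => ?_⟩
  refine Finset.mem_filter.mpr ⟨hfin.mem_toFinset.mpr ?_, latticeRep_latticeRep hσ hτ x⟩
  have hxK : latticeRep σ τ x ∈ (fun z => σ⁻¹ * z) '' K := ⟨_, hmem (σ * x), rfl⟩
  rwa [Function.mem_support, MeromorphicOn.divisor_apply hh.meromorphicOn hxK]

end divisor

/-! ### Factorization and the main theorem. -/

/-- The factorization of a doubly quasiperiodic function into elliptic numbers. -/
lemma IsDoublyQuasiperiodic.exists_eq_thetaQuotient {σ τ a b γ : ℂ} (hσ : σ ≠ 0)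
    (hτ : 0 < τ.im) {h : ℂ → ℂ} (hh : Meromorphic h) (hne : ¬ ∀ᶠ x in codiscrete ℂ, h x = 0)
    (hq : IsDoublyQuasiperiodic σ τ a b γ h) :
    ∃ (r s : ℕ) (u : Fin r → ℂ) (v : Fin s → ℂ) (β y : ℂ), y ≠ 0 ∧
      (∀ᶠ x in codiscrete ℂ, h x = thetaQuotient σ τ u v β y x) ∧
      ∀ x : ℂ, ellProd σ τ v x = 0 → meromorphicOrderAt h x < 0 := by
  obtain ⟨ha, hb⟩ := hq.multipliers_ne_zero hne
  have p1 : Function.Periodic (meromorphicOrderAt h) σ⁻¹ :=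
    periodic_meromorphicOrderAt (g := fun _ => a) (by fun_prop) (fun _ => ha) hq.1
  have p2 : Function.Periodic (meromorphicOrderAt h) (τ * σ⁻¹) :=
    periodic_meromorphicOrderAt (by fun_prop) (fun x => mul_ne_zero hb (exp_ne_zero _)) hq.2
  -- An infinite order at one point spreads over the connected plane.
  have htop (x : ℂ) : meromorphicOrderAt h x ≠ ⊤ := by
    intro hx
    refine hne (eventually_codiscrete_iff.mpr fun z => meromorphicOrderAt_eq_top_iff.mp ?_)
    by_contra hz
    exact (hh.meromorphicOn (s := Set.univ)).meromorphicOrderAt_ne_top_of_isPreconnected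
      isPreconnected_univ (Set.mem_univ z) (Set.mem_univ x) hz hx
  obtain ⟨S, hS, hSmem⟩ := exists_finset_latticeRep hσ hτ hh
  set d : ℂ → ℤ := fun x => (meromorphicOrderAt h x).untop₀ with hd
  have hdx (x : ℂ) : meromorphicOrderAt h x = (d x : WithTop ℤ) :=
    (WithTop.coe_untop₀_of_ne_top (htop x)).symm
  have hdrep (x : ℂ) : d (latticeRep σ τ x) = d x := by
    simp only [hd, p1.latticeRep hσ hτ p2]
  -- Truncation to `ℕ` splits the divisor into zeros (`u`) and poles (`v`) with no common point,
  -- which later confines the zeros of the denominator to poles of `h`.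
  obtain ⟨r, u, hu⟩ := exists_ellProd_eq_prod_pow σ τ S fun z => (d z).toNat
  obtain ⟨s, v, hv⟩ := exists_ellProd_eq_prod_pow σ τ S fun z => (-d z).toNat
  -- `u` and `v` are swapped: this is the reciprocal quotient, which cancels the divisor of `h`.
  have hmu := meromorphic_thetaQuotient σ hτ v u 0 1
  have hk : thetaQuotient σ τ v u 0 1 = fun x => ellProd σ τ v x / ellProd σ τ u x := by
    ext x
    simp [thetaQuotient]
  have hord (x : ℂ) :
      meromorphicOrderAt (fun x => h x * thetaQuotient σ τ v u 0 1 x) x = 0 := by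
    rw [fun_meromorphicOrderAt_mul (hh x) (hmu x), hk,
      fun_meromorphicOrderAt_div ((differentiable_ellProd σ hτ v).analyticAt x).meromorphicAt
      ((differentiable_ellProd σ hτ u).analyticAt x).meromorphicAt, funext hu, funext hv,
      meromorphicOrderAt_prod_ellNum_pow hσ hτ hS, meromorphicOrderAt_prod_ellNum_pow hσ hτ hS,
      hdx x]
    have hsum {A B : ℤ} (hAB : d x + (A - B) = 0) :
        (d x : WithTop ℤ) + ((A : WithTop ℤ) - (B : WithTop ℤ)) = 0 := by
      exact_mod_cast hAB
    refine hsum ?_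
    have hx : d (latticeRep σ τ x) ≠ 0 → latticeRep σ τ x ∈ S := hSmem x
    rw [hdrep] at hx ⊢
    split_ifs with hm
    · omega
    · have : d x = 0 := by_contra fun h0 => hm (hx h0)
      omega
  obtain ⟨F, hF, hFeq, hF0⟩ := (hh.fun_mul hmu).exists_differentiable fun x => (hord x).ge
  have h0 : MultiplierRelations σ τ _ _ _ v u 0 := ⟨rfl, rfl, rfl⟩
  have hFq := (hq.mul (h0.isDoublyQuasiperiodic hσ 1)).congr hFeq
  obtain ⟨c, y, hy, hFexp⟩ := hFq.exists_eq_exp hσ hτ hF fun x => hF0 x (hord x)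
  -- `β` solves `q^{βx} = e^{cx}`.
  refine ⟨r, s, u, v, c / (2 * Real.pi * I * σ), y, hy, ?_, fun x hx => ?_⟩
  · filter_upwards [hFeq, eventually_ellProd_ne_zero hσ hτ u, eventually_ellProd_ne_zero hσ hτ v]
      with x h1 h2 h3
    have hc : 2 * Real.pi * I * σ * (c / (2 * Real.pi * I * σ) * x) = c * x := by
      rw [← mul_assoc, mul_div_cancel₀ _ (mul_ne_zero two_pi_I_ne_zero hσ)]
    rw [hFexp, hk] at h1
    rw [thetaQuotient, hc]
    field_simp at h1 ⊢
    linear_combination h1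
  · rw [hv, Finset.prod_eq_zero_iff] at hx
    obtain ⟨z, hz, hzx⟩ := hx
    obtain ⟨hz0, hzn⟩ := pow_eq_zero_iff'.mp hzx
    rw [ellNum_eq_zero_iff hσ hτ, mul_sub_mem_periodLattice_iff hσ hτ (hS z hz)] at hz0
    rw [hdx, ← hdrep, hz0]
    exact_mod_cast (by omega : d z < 0)

end

theorem theorem1 (σ τ : ℂ) (hσ : 0 < σ.im) (hτ : 0 < τ.im) :
    -- every nonzero doubly quasiperiodic meromorphic function has the stated form
    (∀ (h : ℂ → ℂ) (a b γ : ℂ),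
      Meromorphic h → ¬ (∀ᶠ x in codiscrete ℂ, h x = 0) →
      IsDoublyQuasiperiodic σ τ a b γ h →
      ∃ (r s : ℕ) (u : Fin r → ℂ) (v : Fin s → ℂ) (β y : ℂ),
        y ≠ 0 ∧
        (∀ᶠ x in codiscrete ℂ, h x = thetaQuotient σ τ u v β y x) ∧
        MultiplierRelations σ τ a b γ u v β ∧
        -- the denominator vanishes only at poles of `h`
        (∀ x : ℂ, ellProd σ τ v x = 0 → meromorphicOrderAt h x < 0)) ∧
    -- for arbitrary parameters the form gives such a function, with exactly these multipliers
    (∀ (r s : ℕ) (u : Fin r → ℂ) (v : Fin s → ℂ) (β y : ℂ),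
      Meromorphic (thetaQuotient σ τ u v β y) ∧
      (y ≠ 0 → ¬ (∀ᶠ x in codiscrete ℂ, thetaQuotient σ τ u v β y x = 0)) ∧
      (∀ a b γ : ℂ, MultiplierRelations σ τ a b γ u v β →
        IsDoublyQuasiperiodic σ τ a b γ (thetaQuotient σ τ u v β y)) ∧
      (∀ a b γ : ℂ, y ≠ 0 →
        IsDoublyQuasiperiodic σ τ a b γ (thetaQuotient σ τ u v β y) →
        MultiplierRelations σ τ a b γ u v β)) := by
  have hσ0 : σ ≠ 0 := by
    rintro rfl
    simp at hσ
  refine ⟨fun h a b γ hh hne hq => ?_, fun r s u v β y => ⟨meromorphic_thetaQuotient σ hτ u v β y,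
    fun hy h0 => ?_, fun a b γ h => h.isDoublyQuasiperiodic hσ0 y,
    fun a b γ hy h => multiplierRelations_of_isDoublyQuasiperiodic hσ0 hτ hy h⟩⟩
  · obtain ⟨r, s, u, v, β, y, hy, heq, hden⟩ := hq.exists_eq_thetaQuotient hσ0 hτ hh hne
    -- The quotient inherits the multipliers of `h`, and uniqueness of multipliers yields the
    -- relations.
    exact ⟨r, s, u, v, β, y, hy, heq,
      multiplierRelations_of_isDoublyQuasiperiodic hσ0 hτ hy (hq.congr heq), hden⟩
  -- Vanishing and nonvanishing cannot both hold off discrete sets; otherwise the constants 1 and 0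
  -- would agree.
  · refine one_ne_zero (α := ℂ) (Continuous.eq_of_eventuallyEq_codiscrete (f := fun _ => 1)
      (g := fun _ => 0) continuous_const continuous_const ?_ 0)
    filter_upwards [h0, eventually_thetaQuotient_ne_zero hσ0 hτ u v β hy] with x h1 h2
    exact absurd h1 h2
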